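/- Let $n\ge 2$ and let $p(z)=a_0z^n+a_1z^{n-1}+\dots+a_n$ be a polynomial with real coefficients and $a_0>0$, $a_n>0$. Put $a_k=0$ for $k<0$ and $k>n$, and let the finite Hurwitz matrix of $p$ be the $n\times n$ matrix $\mathcal H_n(p)=(a_{2j-i})_{i,j=1}^n$. Put $$\alpha_n=\begin{cases}\dfrac{\pi}{4}\cdot\dfrac{n+1}{n-1}, & n\text{ odd},\\[2mm] \dfrac{\pi}{4}\cdot\dfrac{n}{n-1}, & n\text{ even}.\end{cases}$$ If $\mathcal H_n(p)$ is totally nonnegative, i.e. all its minors are nonnegative, then $p$ has no zeros in the sector $|\arg z|<\alpha_n$. The constant $\alpha_n$ is sharp for every $n\ge2$: the polynomial $$\prod_{j=1}^{n/2}\left(z^2+e^{\,i\frac{\pi}{2}\cdot\frac{n-4j+2}{n-1}}\right)\ (n\text{ even}),\qquad (z+1)\prod_{j=1}^{(n-1)/2}\left(z^2+e^{\,i\frac{\pi}{2}\cdot\frac{n-4j+1}{n-1}}\right)\ (n\text{ odd})$$ has real coefficients, degree $n$, positive leading coefficient and positive constant term, its finite Hurwitz matrix is totally nonnegative, and it has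 a zero $z\neq0$ with $|\arg z|=\alpha_n$. -/

import Mathlib

open Polynomial

noncomputable section

/-- A real matrix is totally nonnegative if all its minors are nonnegative; a minor is the
determinant of the square submatrix on strictly increasing rows `r` and columns `c`. -/
def IsTotallyNonneg {n m : ℕ} (A : Matrix (Fin n) (Fin m) ℝ) : Prop :=
  ∀ (k : ℕ) (r : Fin k ↪o Fin n) (c : Fin k ↪o Fin m), 0 ≤ (A.submatrix r c).det

/-- The coefficients of a polynomial of degree `n` numbered in descending order,
`p(z) = a₀ zⁿ + a₁ zⁿ⁻¹ + ⋯ + aₙ`, and extended by zero to all integer indices. -/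
def descCoeff (n : ℕ) (p : ℝ[X]) (k : ℤ) : ℝ :=
  if 0 ≤ k ∧ k ≤ n then p.coeff (n - k.toNat) else 0

/-- The finite `n × n` Hurwitz matrix of a polynomial of degree `n`. With rows and columns
numbered from `1` its entries are `a_{2j-i}`; here `i` and `j` are numbered from `0`. -/
def hurwitzMatrix (n : ℕ) (p : ℝ[X]) : Matrix (Fin n) (Fin n) ℝ :=
  Matrix.of fun i j => descCoeff n p (2 * ((j : ℕ) + 1 : ℤ) - ((i : ℕ) + 1 : ℤ))

/-- Half the opening of the zero-free sector. -/
def sectorAngle (n : ℕ) : ℝ :=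
  if Odd n then Real.pi / 4 * (((n : ℝ) + 1) / ((n : ℝ) - 1))
  else Real.pi / 4 * ((n : ℝ) / ((n : ℝ) - 1))

/-- The extremal product: `(z + 1) ∏_{j=1}^{(n-1)/2} (z² + exp(i (π/2) (n-4j+1)/(n-1)))` for odd
`n`, and `∏_{j=1}^{n/2} (z² + exp(i (π/2) (n-4j+2)/(n-1)))` for even `n`. -/
def extremalPoly (n : ℕ) : ℂ[X] :=
  if Odd n then
    (X + 1) * ∏ j ∈ Finset.Icc 1 ((n - 1) / 2),
      (X ^ 2 + C (Complex.exp (Complex.I *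
        ((Real.pi / 2 * (((n : ℝ) - 4 * (j : ℝ) + 1) / ((n : ℝ) - 1)) : ℝ) : ℂ))))
  else
    ∏ j ∈ Finset.Icc 1 (n / 2),
      (X ^ 2 + C (Complex.exp (Complex.I *
        ((Real.pi / 2 * (((n : ℝ) - 4 * (j : ℝ) + 2) / ((n : ℝ) - 1)) : ℝ) : ℂ))))

end

/-! Write the reversed polynomial as `e(w²) + w o(w²)`. The rows of the Hurwitz matrix are then
alternately rows of the Toeplitz matrices of `o` and `e`, and a zero `z` of `p` becomes the zero `w
= z⁻¹`.

Routh elimination keeps the minors in initial rows nonnegative and yields `Re(e(w²) · conj(w o(w²)))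
≥ 0` for `Re w ≥ 0`. At a zero with `Re w > 0` this quantity is `-|e(w²)|²`, so `e` and `o` both
vanish at `w²` (`InitialMinorsNonneg.aeval_eq_zero`). It remains to keep one of them from vanishing
there: `e` for even `n`, `o` for odd `n`.

That is a Schoenberg-type theorem (`aeval_ne_zero_of_toeplitz`). A zero of `h` with argument `ψ`
gives the linear relation with coefficients `Im(e^{iδ} ζ^j)` between the columns of the Toeplitz
matrix of `h`, and its number of sign changes is controlled by `(n - 1)ψ`. If this number is `k - 1`
with `k ≤ r`, the first `k` columns of the `k`-row section are dependent (`det_initial_eq_zero`),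
although that minor is `h(0)^k > 0`. With `r = ⌊(n + 1)/2⌋` the bound `ψ < rπ/(n - 1)` is `|arg z| <
α_n`.

For sharpness, `e` has Gaussian binomial coefficients at `q = exp(2πi/(n - 1))`, and `o` equals `e`
or is zero. Their Toeplitz matrices factor, up to diagonal scalings, into bidiagonal matrices with
nonnegative entries (`sin_mul_toeplitzEntry_gaussCoeff`), hence have nonnegative minors in the
required range. -/

/-! ### Initial minors of the Hurwitz matrix and the Routh scheme. -/

/-- The entries of the upper triangular Toeplitz matrix with symbol `h`. -/
def toeplitzEntry (h : ℕ → ℝ) (i j : ℕ) : ℝ := if i ≤ j then h (j - i) else 0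

theorem toeplitzEntry_succ_succ (h : ℕ → ℝ) (i j : ℕ) :
    toeplitzEntry h (i + 1) (j + 1) = toeplitzEntry h i j := by
  simp [toeplitzEntry]

/-- The entries of the infinite Hurwitz matrix of `e(z²) + z o(z²)`, with coefficients in ascending
order. -/
def hurwitzEntry (e o : ℝ[X]) (i j : ℕ) : ℝ :=
  if Even i then toeplitzEntry o.coeff (i / 2) j else toeplitzEntry e.coeff (i / 2) j

/-- Nonnegativity of the minors that lie in initial rows of the `n × n` Hurwitz matrix. -/
def InitialMinorsNonneg (n : ℕ) (e o : ℝ[X]) : Prop :=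
  ∀ k ≤ n, ∀ c : Fin k → ℕ, StrictMono c → (∀ i, c i < n) →
    0 ≤ (Matrix.of fun i j : Fin k => hurwitzEntry e o i (c j)).det

theorem InitialMinorsNonneg.odd_coeff_nonneg {n : ℕ} {e o : ℝ[X]} (h : InitialMinorsNonneg n e o)
    {j : ℕ} (hj : j < n) : 0 ≤ o.coeff j := by
  have := h 1 (by omega) (fun _ => j) (Subsingleton.strictMono _) (fun _ => hj)
  simpa [hurwitzEntry, toeplitzEntry] using this

/-- The minor in rows `0, 1` and columns `0, j` is `-o_j e_0`, which forces `o_j ≤ 0`. This is the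
degenerate case in which the Routh step cannot divide by `o_0`. -/
theorem InitialMinorsNonneg.odd_eq_zero {n : ℕ} {e o : ℝ[X]} (h : InitialMinorsNonneg n e o)
    (he : 0 < e.coeff 0) (hdeg : ∀ k, n < 2 * k + 1 → o.coeff k = 0) (ho : o.coeff 0 = 0) :
    o = 0 := by
  ext j
  rcases Nat.eq_zero_or_pos j with rfl | hj
  · simpa using ho
  rcases lt_or_ge n (2 * j + 1) with hn | hn
  · simpa using hdeg j hn
  have h1 := h.odd_coeff_nonneg (j := j) (by omega)
  have h2 := h 2 (by omega) ![0, j] (by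
      rw [Fin.strictMono_iff_lt_succ]; intro i; fin_cases i; simpa using hj)
      (by intro i; fin_cases i <;> simp <;> omega)
  rw [Matrix.det_fin_two] at h2
  simp [hurwitzEntry, toeplitzEntry, ho] at h2
  have : o.coeff j ≤ 0 := by
    by_contra hc
    push Not at hc
    nlinarith [mul_pos hc he]
  simpa using le_antisymm this h1

/-- One step of the Routh scheme. -/
theorem InitialMinorsNonneg.routh_step {n : ℕ} {e o q : ℝ[X]} {c : ℝ}
    (h : InitialMinorsNonneg (n + 1) e o) (ho : 0 < o.coeff 0) (hq : e = C c * o + X * q) :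
    InitialMinorsNonneg n o q := by
  intro k hk r hr hrn
  have hc0 : e.coeff 0 = c * o.coeff 0 := by simp [hq]
  have hcs : ∀ j, e.coeff (j + 1) = c * o.coeff (j + 1) + q.coeff j := by simp [hq, coeff_X_mul]
  -- Bordering by column `0` and shifting the other columns by one undoes the deletion of the first
  -- row and column after elimination.
  set r' : Fin (k + 1) → ℕ := Fin.cons 0 (fun i => r i + 1) with hr'
  have key := h (k + 1) (by omega) r' (by
      rw [hr', Fin.strictMono_cons]
      exact ⟨fun _ => Nat.succ_pos _, fun _ _ h => Nat.succ_lt_succ (hr h)⟩) (by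
      intro i; refine Fin.cases ?_ (fun i => ?_) i
      · simp [hr']
      · simpa [hr'] using hrn i)
  -- Subtracting `c` times the row of `o` above from each row of `e` leaves a row of `X * q`; column
  -- `0` is then cleared below its corner `o.coeff 0`.
  set B : Matrix (Fin (k + 1)) (Fin (k + 1)) ℝ := Matrix.of (fun i j =>
    (Fin.cons (hurwitzEntry e o 0 (r' j)) (fun i : Fin k => hurwitzEntry e o (i + 1) (r' j) -
      (if Even (i : ℕ) then c else 0) * hurwitzEntry e o i (r' j)) : Fin (k + 1) → ℝ) i) with hB
  rw [Matrix.det_eq_of_forall_row_eq_smul_add_pred (B := B)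
    (fun i : Fin k => if Even (i : ℕ) then c else 0) (by intro j; simp [hB])
    (by intro i j; simp [hB])] at key
  have hcol : ∀ i : Fin k, B i.succ 0 = 0 := by
    intro i
    simp only [hB, hr', Matrix.of_apply, Fin.cons_succ, Fin.cons_zero, hurwitzEntry, toeplitzEntry]
    rcases Nat.even_or_odd' (i : ℕ) with ⟨u, hu | hu⟩
    · have h1 : (i : ℕ) / 2 = u := by omega
      have h2 : ((i : ℕ) + 1) / 2 = u := by omega
      have h3 : Even (i : ℕ) := ⟨u, by omega⟩
      have h4 : ¬ Even ((i : ℕ) + 1) := by simpa [Nat.even_add_one] using h3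
      simp only [h1, h2, h3, h4, if_true, if_false]
      rcases Nat.eq_zero_or_pos u with rfl | hu
      · simp [hc0]
      · simp [hu.ne']
    · have h2 : ((i : ℕ) + 1) / 2 = u + 1 := by omega
      have h3 : ¬ Even (i : ℕ) := by rw [Nat.not_even_iff_odd]; exact ⟨u, by omega⟩
      have h4 : Even ((i : ℕ) + 1) := by simpa [Nat.even_add_one] using h3
      simp [h2, h3, h4]
  have hsub : B.submatrix (Fin.succAbove 0) Fin.succ =
      Matrix.of fun i j : Fin k => hurwitzEntry o q i (r j) := by
    ext i j
    simp only [hB, hr', Matrix.of_apply, Matrix.submatrix_apply, Fin.succAbove_zero, Fin.cons_succ,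
      hurwitzEntry]
    rcases Nat.even_or_odd' (i : ℕ) with ⟨u, hu | hu⟩
    · have h1 : (i : ℕ) / 2 = u := by omega
      have h2 : ((i : ℕ) + 1) / 2 = u := by omega
      have h3 : Even (i : ℕ) := ⟨u, by omega⟩
      have h4 : ¬ Even ((i : ℕ) + 1) := by simpa [Nat.even_add_one] using h3
      simp only [h1, h2, h3, h4, if_true, if_false, toeplitzEntry]
      rcases lt_trichotomy u (r j + 1) with hlt | heq | hgt
      · rw [if_pos hlt.le, if_pos hlt.le, if_pos (by omega), Nat.succ_sub (by omega), hcs]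
        ring
      · simp [heq, hc0]
      · rw [if_neg (by omega), if_neg (by omega), if_neg (by omega)]; simp
    · have h1 : (i : ℕ) / 2 = u := by omega
      have h2 : ((i : ℕ) + 1) / 2 = u + 1 := by omega
      have h3 : ¬ Even (i : ℕ) := by rw [Nat.not_even_iff_odd]; exact ⟨u, by omega⟩
      have h4 : Even ((i : ℕ) + 1) := by simpa [Nat.even_add_one] using h3
      simp [h1, h2, h3, h4, toeplitzEntry_succ_succ]
  rw [Matrix.det_succ_column_zero, Fin.sum_univ_succ] at key
  simp only [hcol, hsub] at key
  have h00 : B 0 0 = o.coeff 0 := by simp [hB, hr', hurwitzEntry, toeplitzEntry]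
  simp [h00] at key
  exact nonneg_of_mul_nonneg_right key ho

open ComplexConjugate in
/-- The even and the odd part of the polynomial form an angle of at most `π / 2` in the right half
plane. -/
theorem InitialMinorsNonneg.re_mul_conj_nonneg {n : ℕ} {e o : ℝ[X]}
    (h : InitialMinorsNonneg n e o) (he : 0 < e.coeff 0)
    (hedeg : ∀ k, n < 2 * k → e.coeff k = 0)
    (hodeg : ∀ k, n < 2 * k + 1 → o.coeff k = 0) {w : ℂ} (hw : 0 ≤ w.re) :
    0 ≤ (aeval (w ^ 2) e * conj (w * aeval (w ^ 2) o)).re := by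
  induction n generalizing e o with
  | zero =>
    have : o = 0 := by ext k; simpa using hodeg k (by omega)
    simp [this]
  | succ n ih =>
    rcases eq_or_ne (o.coeff 0) 0 with ho | ho
    · simp [h.odd_eq_zero he hodeg ho]
    have ho : 0 < o.coeff 0 := lt_of_le_of_ne (h.odd_coeff_nonneg (by omega)) ho.symm
    set c := e.coeff 0 / o.coeff 0 with hc
    have hc0 : 0 < c := div_pos he ho
    set q := (e - C c * o).divX with hq
    have heq : e = C c * o + X * q := by
      have h1 := X_mul_divX_add (e - C c * o)
      have h2 : (e - C c * o).coeff 0 = 0 := by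
        simp [hc, div_mul_cancel₀ _ ho.ne']
      rw [h2, C_0, add_zero] at h1
      rw [hq, h1]; ring
    have key := ih (h.routh_step ho heq) ho (fun k hk => hodeg k (by omega)) (fun k hk => by
      rw [hq, coeff_divX, coeff_sub, coeff_C_mul, hedeg _ (by omega), hodeg _ (by omega)]; simp)
    rw [heq]
    simp only [map_add, map_mul, aeval_C, aeval_X, Complex.coe_algebraMap]
    set O := aeval (w ^ 2) o
    set Q := aeval (w ^ 2) q
    -- Since `w² · conj w = |w|² w`, the second term is the same expression for the next Routh pair
    -- `(o, q)`.
    have e1 : ((c * O + w ^ 2 * Q) * (conj w * conj O)).re =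
        c * w.re * Complex.normSq O + Complex.normSq w * (O * conj (w * Q)).re := by
      simp [Complex.normSq_apply, pow_two]
      ring
    rw [e1]
    have := Complex.normSq_nonneg O
    have := Complex.normSq_nonneg w
    positivity

theorem InitialMinorsNonneg.aeval_eq_zero {n : ℕ} {e o : ℝ[X]}
    (h : InitialMinorsNonneg n e o) (he : 0 < e.coeff 0)
    (hedeg : ∀ k, n < 2 * k → e.coeff k = 0)
    (hodeg : ∀ k, n < 2 * k + 1 → o.coeff k = 0) {w : ℂ} (hw : 0 < w.re)
    (h0 : aeval (w ^ 2) e + w * aeval (w ^ 2) o = 0) :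
    aeval (w ^ 2) e = 0 ∧ aeval (w ^ 2) o = 0 := by
  have key := h.re_mul_conj_nonneg he hedeg hodeg hw.le
  have h1 : w * aeval (w ^ 2) o = - aeval (w ^ 2) e := by linear_combination h0
  rw [h1, map_neg, mul_neg, Complex.mul_conj] at key
  have h2 : aeval (w ^ 2) e = 0 := by
    rw [← Complex.normSq_eq_zero]
    refine le_antisymm ?_ (Complex.normSq_nonneg _)
    simpa using key
  refine ⟨h2, ?_⟩
  have h3 : w ≠ 0 := by rintro rfl; simp at hw
  rw [h2, neg_zero] at h1
  exact (mul_eq_zero.mp h1).resolve_left h3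

/-! ### Sign changes of linear relations and vanishing minors. -/

/-- If the vectors `v j` have nonnegative maximal minors and satisfy a linear relation whose
coefficients alternate in sign along the blocks of `β`, then the minors that take one vector of
each block vanish. -/
theorem det_transversal_eq_zero {k n : ℕ} (hk : 0 < k) {v : Fin n → Fin k → ℝ} {x : Fin n → ℝ}
    {β : Fin n → Fin k} (hβ : Monotone β)
    (hv : ∀ J : Fin k → Fin n, StrictMono J → 0 ≤ (Matrix.of fun b => v (J b)).det)
    (hx : ∑ j, x j • v j = 0) (hs : ∀ j, 0 < (-1) ^ (β j : ℕ) * x j)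
    {J : Fin k → Fin n} (hJ : ∀ b, β (J b) = b) :
    (Matrix.of fun b => v (J b)).det = 0 := by
  -- Merging each block into one vector with weights `|x j|` gives `k` vectors whose alternating sum
  -- is zero. Expanding their determinant yields nonnegative terms only, so every term vanishes.
  set w : Fin k → Fin n → ℝ := fun b j => if β j = b then |x j| else 0 with hw
  have habs : ∀ j, (-1) ^ (β j : ℕ) * |x j| = x j := by
    intro j
    rcases neg_one_pow_eq_or ℝ (β j : ℕ) with h | h <;> have := hs j <;> rw [h] at this ⊢
    · rw [abs_of_pos (by linarith)]; ring
    · rw [abs_of_neg (by linarith)]; ring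
  have hdet : (Matrix.of fun b => ∑ j, w b j • v j).det = 0 := by
    rw [← Matrix.exists_vecMul_eq_zero_iff]
    refine ⟨fun b => (-1) ^ (b : ℕ), fun h => ?_, ?_⟩
    · simpa using congrFun h ⟨0, hk⟩
    · have h1 : ∀ j, ∑ b : Fin k, ((-1 : ℝ) ^ (b : ℕ) * w b j) = x j := by
        intro j
        simp [hw, habs]
      funext i
      have h2 := congrFun hx i
      simp only [Finset.sum_apply, Pi.smul_apply, smul_eq_mul, Pi.zero_apply] at h2
      simp only [Matrix.vecMul, dotProduct, Matrix.of_apply, Finset.sum_apply, Pi.smul_apply,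
        smul_eq_mul, Pi.zero_apply, Finset.mul_sum]
      rw [Finset.sum_comm, ← h2]
      refine Finset.sum_congr rfl fun j _ => ?_
      rw [← h1 j, Finset.sum_mul]
      exact Finset.sum_congr rfl fun b _ => by ring
  have hexp : (Matrix.of fun b => ∑ j, w b j • v j).det =
      ∑ r : Fin k → Fin n, (∏ b, w b (r b)) * (Matrix.of fun b => v (r b)).det := by
    have h1 := (Matrix.detRowAlternating (R := ℝ) (n := Fin k)).toMultilinearMap.map_sum
      (fun b (j : Fin n) => w b j • v j)
    have h2 : ∀ r : Fin k → Fin n,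
        (Matrix.detRowAlternating (R := ℝ) (n := Fin k)).toMultilinearMap
          (fun b => w b (r b) • v (r b)) =
        (∏ b, w b (r b)) * (Matrix.of fun b => v (r b)).det := by
      intro r
      rw [MultilinearMap.map_smul_univ]
      rfl
    simp only [h2] at h1
    exact h1
  rw [hexp, Finset.sum_eq_zero_iff_of_nonneg] at hdet
  · have h1 := hdet J (Finset.mem_univ _)
    refine (mul_eq_zero.mp h1).resolve_left (Finset.prod_ne_zero_iff.mpr fun b _ => ?_)
    have := hs (J b)
    simp only [hw, hJ, if_true]
    exact abs_ne_zero.mpr fun h => by simp [h] at this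
  · intro r _
    by_cases hr : ∀ b, β (r b) = b
    · refine mul_nonneg (Finset.prod_nonneg fun b _ => ?_) (hv r fun a b hab => ?_)
      · simp only [hw]; split_ifs <;> simp
      · by_contra hle
        have := hβ (not_lt.mp hle)
        rw [hr, hr] at this
        exact absurd hab (not_lt.mpr this)
    · push Not at hr
      obtain ⟨b, hb⟩ := hr
      rw [Finset.prod_eq_zero (Finset.mem_univ b) (by simp [hw, hb]), zero_mul]

/-- The minor `J` vanishes for all families of vectors with nonnegative maximal minors that satisfy
a linear relation with the sign pattern `s`. -/
def MinorVanishes {k n : ℕ} (s : Fin n → ℝ) (J : Fin k → Fin n) : Prop :=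
  ∀ (v : Fin n → Fin k → ℝ) (x : Fin n → ℝ),
    (∀ J : Fin k → Fin n, StrictMono J → 0 ≤ (Matrix.of fun b => v (J b)).det) →
    ∑ j, x j • v j = 0 → (∀ j, 0 < s j * x j) → (Matrix.of fun b => v (J b)).det = 0

theorem det_update_add_smul {k n : ℕ} (v : Fin n → Fin k → ℝ) {i j : Fin n} (ε : ℝ)
    {J : Fin k → Fin n} (hJ : Function.Injective J) {b : Fin k} (hb : J b = j) :
    (Matrix.of fun a => Function.update v j (v j + ε • v i) (J a)).det =
      (Matrix.of fun a => v (J a)).det +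
        ε * (Matrix.of fun a => v (Function.update J b i a)).det := by
  have e1 : (Matrix.of fun a => Function.update v j (v j + ε • v i) (J a)) =
      (Matrix.of fun a => v (J a)).updateRow b (v j + ε • v i) := by
    ext a c
    rcases eq_or_ne a b with rfl | h
    · simp [hb]
    · rw [Matrix.updateRow_ne h]
      simp [Function.update_of_ne (fun h' => h (hJ (h'.trans hb.symm)) : J a ≠ j)]
  have e2 : (Matrix.of fun a => v (J a)).updateRow b (v i) =
      Matrix.of fun a => v (Function.update J b i a) := by
    ext a c
    rcases eq_or_ne a b with rfl | h
    · simp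
    · rw [Matrix.updateRow_ne h]
      simp [Function.update_of_ne h]
  have e3 : (Matrix.of fun a => v (J a)).updateRow b (v j) = Matrix.of fun a => v (J a) := by
    rw [← hb]; exact Matrix.updateRow_eq_self _ _
  rw [e1, Matrix.det_updateRow_add, Matrix.det_updateRow_smul, e2, e3]

/-- Adding `ε` times `v i` to its right neighbour preserves nonnegativity of the maximal minors
because the two indices are adjacent. The minor `J` of the new family is the old one plus `ε` times
the updated one; the sum vanishes and both terms are nonnegative. -/
theorem MinorVanishes.update_pred {k n : ℕ} {s : Fin n → ℝ} (hs : ∀ j, |s j| = 1)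
    {J : Fin k → Fin n} (h : MinorVanishes s J) (hJ : StrictMono J) {b : Fin k} {i : Fin n}
    (hi : (i : ℕ) + 1 = J b) (hJ' : StrictMono (Function.update J b i)) :
    MinorVanishes s (Function.update J b i) := by
  intro v x hv hx hsx
  have hx0 : ∀ j, 0 < |x j| := fun j => abs_pos.mpr fun h => by simpa [h] using hsx j
  have habs : ∀ j, s j * x j = |x j| := fun j => by
    rw [← abs_of_pos (hsx j), abs_mul, hs, one_mul]
  have hij : i ≠ J b := fun h => by have := congrArg Fin.val h; omega
  -- The corrected coefficient `x i - ε * x (J b)` keeps the sign of `x i`, since the correction is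
  -- half as large.
  set ε := |x i| / (2 * |x (J b)|) with hε
  have hε0 : 0 < ε := by have := hx0 i; have := hx0 (J b); positivity
  have key := h (Function.update v (J b) (v (J b) + ε • v i))
    (Function.update x i (x i - ε * x (J b))) ?_ ?_ ?_
  · rw [det_update_add_smul v ε hJ.injective rfl] at key
    have h1 := hv J hJ
    have h2 := hv _ hJ'
    have h3 : ε * (Matrix.of fun a => v (Function.update J b i a)).det = 0 := by
      have := mul_nonneg hε0.le h2
      linarith
    exact (mul_eq_zero.mp h3).resolve_left hε0.ne'
  · intro K hK
    by_cases hmem : ∃ a, K a = J b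
    · obtain ⟨a, ha⟩ := hmem
      rw [det_update_add_smul v ε hK.injective ha]
      refine add_nonneg (hv K hK) (mul_nonneg hε0.le ?_)
      by_cases hmem' : ∃ a', K a' = i
      · obtain ⟨a', ha'⟩ := hmem'
        have hne : a' ≠ a := by rintro rfl; exact hij (ha'.symm.trans ha)
        refine (Matrix.det_zero_of_row_eq hne ?_).ge
        change v (Function.update K a i a') = v (Function.update K a i a)
        rw [Function.update_self, Function.update_of_ne hne, ha']
      · push Not at hmem'
        refine hv _ fun c d hcd => ?_
        have hKcd := hK hcd
        rcases eq_or_ne c a with rfl | hc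
        · rw [Function.update_self, Function.update_of_ne hcd.ne']
          rw [ha] at hKcd
          exact lt_trans (by rw [Fin.lt_def]; omega) hKcd
        · rw [Function.update_of_ne hc]
          rcases eq_or_ne d a with rfl | hd
          · rw [Function.update_self]
            refine lt_of_le_of_ne ?_ (hmem' c)
            rw [ha, Fin.lt_def] at hKcd
            rw [Fin.le_def]; omega
          · rwa [Function.update_of_ne hd]
    · push Not at hmem
      simp only [Function.update_of_ne (hmem _)]
      exact hv K hK
  · have e1 : ∀ j, Function.update x i (x i - ε * x (J b)) j •
        Function.update v (J b) (v (J b) + ε • v i) j = x j • v j +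
          ((if j = J b then (x (J b) * ε) • v i else 0) -
            (if j = i then (x (J b) * ε) • v i else 0)) := by
      intro j
      rcases eq_or_ne j i with rfl | hj
      · rw [Function.update_self, Function.update_of_ne hij, if_neg hij, if_pos rfl, sub_smul,
          mul_comm ε]
        abel
      · rw [Function.update_of_ne hj, if_neg hj]
        rcases eq_or_ne j (J b) with rfl | hj
        · rw [Function.update_self, if_pos rfl, smul_add, smul_smul]; simp
        · rw [Function.update_of_ne hj, if_neg hj]; simp
    simp only [e1, Finset.sum_add_distrib, Finset.sum_sub_distrib, hx]
    simp
  · intro j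
    rcases eq_or_ne j i with rfl | hj
    · rw [Function.update_self, mul_sub, habs]
      have h1 : s j * (ε * x (J b)) ≤ |x j| / 2 := by
        refine (le_abs_self _).trans ?_
        rw [abs_mul, abs_mul, hs, one_mul, abs_of_pos hε0, hε]
        have := (hx0 (J b)).ne'
        field_simp
        rfl
      have := hx0 j
      linarith
    · rw [Function.update_of_ne hj]; exact hsx j

theorem MinorVanishes.castLE {k n : ℕ} {s : Fin n → ℝ} (hs : ∀ j, |s j| = 1) (hkn : k ≤ n)
    {J : Fin k → Fin n} (hJ : StrictMono J) (h : MinorVanishes s J) :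
    MinorVanishes s (Fin.castLE hkn) := by
  induction hN : ∑ b, (J b : ℕ) using Nat.strong_induction_on generalizing J with
  | _ N ih =>
    by_cases hex : ∃ b, (J b : ℕ) ≠ b
    -- At the least index where `J` differs from the initial embedding, the slot just below `J b` is
    -- free, so lowering `J b` by one keeps `J` increasing.
    · obtain ⟨b, hb, hmin⟩ : ∃ b : Fin k, (J b : ℕ) ≠ b ∧ ∀ a < b, (J a : ℕ) = a := by
        obtain ⟨b, hb, hmin⟩ := WellFounded.has_min (wellFounded_lt (α := Fin k))
          {b | (J b : ℕ) ≠ b} hex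
        exact ⟨b, hb, fun a ha => by_contra fun h' => hmin a h' ha⟩
      have hle : ∀ a : Fin k, (a : ℕ) ≤ J a := by
        rintro ⟨a, ha⟩
        induction a with
        | zero => exact Nat.zero_le _
        | succ a iha =>
          have h1 := iha (by omega)
          have h2 : J ⟨a, by omega⟩ < J ⟨a + 1, ha⟩ := hJ (by simp [Fin.lt_def])
          rw [Fin.lt_def] at h2
          simp only at h1 ⊢
          omega
      have hbJ : (b : ℕ) < J b := lt_of_le_of_ne (hle b) (Ne.symm hb)
      set i : Fin n := ⟨J b - 1, by omega⟩ with hi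
      have hi' : (i : ℕ) + 1 = J b := by simp only [hi]; omega
      have hJ' : StrictMono (Function.update J b i) := by
        intro c d hcd
        have hcd' := hJ hcd
        rcases eq_or_ne c b with rfl | hc
        · rw [Function.update_self, Function.update_of_ne hcd.ne']
          rw [Fin.lt_def] at hcd' ⊢; omega
        · rw [Function.update_of_ne hc]
          rcases eq_or_ne d b with rfl | hd
          · rw [Function.update_self, Fin.lt_def, hmin c hcd]
            rw [Fin.lt_def] at hcd; omega
          · rwa [Function.update_of_ne hd]
      refine ih _ ?_ hJ' (h.update_pred hs hJ hi' hJ') rfl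
      rw [← hN]
      refine Finset.sum_lt_sum (fun a _ => ?_) ⟨b, Finset.mem_univ _, ?_⟩
      · rcases eq_or_ne a b with rfl | ha
        · rw [Function.update_self]; omega
        · rw [Function.update_of_ne ha]
      · rw [Function.update_self]; omega
    · push Not at hex
      have : J = Fin.castLE hkn := by
        funext b; ext; simpa using hex b
      rwa [this] at h

/-- If a family of `n` vectors in `ℝᵏ` with nonnegative maximal minors satisfies a linear relation
with exactly `k - 1` sign changes and no zero coefficient, its first `k` members are dependent. -/
theorem det_initial_eq_zero {k n : ℕ} (hk : 0 < k) (hkn : k ≤ n) {v : Fin n → Fin k → ℝ}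
    {x : Fin n → ℝ} {β : Fin n → Fin k} (hβ : Monotone β) (hβs : Function.Surjective β)
    (hv : ∀ J : Fin k → Fin n, StrictMono J → 0 ≤ (Matrix.of fun b => v (J b)).det)
    (hx : ∑ j, x j • v j = 0) (hs : ∀ j, 0 < (-1) ^ (β j : ℕ) * x j) :
    (Matrix.of fun b => v (Fin.castLE hkn b)).det = 0 := by
  choose J hJ using hβs
  have hmono : StrictMono J := fun a b hab => by
    by_contra hle
    have := hβ (not_lt.mp hle)
    rw [hJ, hJ] at this
    exact absurd hab (not_lt.mpr this)
  have h : MinorVanishes (fun j => (-1) ^ (β j : ℕ)) J :=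
    fun v x hv hx hs => det_transversal_eq_zero hk hβ hv hx hs hJ
  exact h.castLE (fun j => by simp) hkn hmono v x hv hx hs

/-! ### Zero-free sectors from truncated Toeplitz matrices. -/

theorem sum_toeplitzEntry_mul_pow (h : ℝ[X]) {n s : ℕ} (hs : h.natDegree + s < n) (z : ℂ) :
    ∑ j : Fin n, (toeplitzEntry h.coeff s j : ℂ) * z ^ (j : ℕ) = z ^ s * aeval z h := by
  rw [Fin.sum_univ_eq_sum_range (fun j => (toeplitzEntry h.coeff s j : ℂ) * z ^ j),
    show n = s + (n - s) by omega, Finset.sum_range_add, Finset.sum_eq_zero, zero_add,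
    aeval_eq_sum_range' (n := n - s) (by omega), Finset.mul_sum]
  · refine Finset.sum_congr (by congr 1) fun j _ => ?_
    simp only [toeplitzEntry, Nat.le_add_right, if_true, Nat.add_sub_cancel_left,
      Complex.real_smul, pow_add]
    ring
  · intro j hj
    rw [Finset.mem_range] at hj
    simp [toeplitzEntry, not_le.mpr hj]

theorem neg_one_pow_floor_mul_sin_pos {y : ℝ} (hy : 0 ≤ y) (hy' : ∀ q : ℕ, y ≠ q * Real.pi) :
    0 < (-1) ^ ⌊y / Real.pi⌋₊ * Real.sin y := by
  set q := ⌊y / Real.pi⌋₊ with hq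
  have h1 : (q : ℝ) ≤ y / Real.pi := Nat.floor_le (by positivity)
  have h2 : y / Real.pi < q + 1 := Nat.lt_floor_add_one _
  rw [le_div_iff₀ Real.pi_pos] at h1
  rw [div_lt_iff₀ Real.pi_pos] at h2
  have h3 : (q : ℝ) * Real.pi < y := lt_of_le_of_ne h1 (hy' q).symm
  have h4 : 0 < Real.sin (y - q * Real.pi) :=
    Real.sin_pos_of_pos_of_lt_pi (by linarith) (by linarith)
  rwa [Real.sin_sub_nat_mul_pi] at h4

/-- A form of Schoenberg's theorem on the zeros of polynomials with a totally nonnegative truncated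
Toeplitz matrix. -/
theorem aeval_ne_zero_of_toeplitz {h : ℝ[X]} {n r : ℕ} (hn : 0 < n)
    (hdeg : h.natDegree + r ≤ n) (h0 : 0 < h.coeff 0)
    (hT : ∀ k ≤ r, ∀ J : Fin k → Fin n, StrictMono J →
      0 ≤ (Matrix.of fun a b : Fin k => toeplitzEntry h.coeff b (J a)).det)
    {ρ ψ : ℝ} (hρ : 0 < ρ) (hψ : 0 ≤ ψ) (hψ' : ψ ≤ Real.pi)
    (hψr : (n - 1) * ψ < r * Real.pi) :
    aeval ((ρ : ℂ) * Complex.exp (ψ * Complex.I)) h ≠ 0 := by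
  intro hroot
  have hpi := Real.pi_pos
  -- Avoiding a countable set makes every `sin(jψ + δ)` nonzero. The bound `δ < π` starts the block
  -- count at `0`, and the other bound keeps the number of blocks at most `r`.
  obtain ⟨δ, hδ, hδ0, hδr⟩ : ∃ δ ∈ (Set.range fun jq : ℕ × ℕ => jq.2 * Real.pi - jq.1 * ψ)ᶜ,
      0 < δ ∧ δ < min Real.pi (r * Real.pi - (n - 1) * ψ) := by
    obtain ⟨δ, h1, h2⟩ := ((Set.countable_range fun jq : ℕ × ℕ =>
      jq.2 * Real.pi - jq.1 * ψ).dense_compl ℝ).exists_between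
      (show 0 < min Real.pi (r * Real.pi - (n - 1) * ψ) from lt_min hpi (by linarith))
    exact ⟨δ, h1, h2⟩
  have hδπ := lt_of_lt_of_le hδr (min_le_left _ _)
  have hδr := lt_of_lt_of_le hδr (min_le_right _ _)
  have hgen : ∀ j q : ℕ, (j : ℝ) * ψ + δ ≠ q * Real.pi := fun j q hjq =>
    hδ ⟨(j, q), by simp only; linarith⟩
  set φ : ℕ → ℕ := fun j => ⌊((j : ℝ) * ψ + δ) / Real.pi⌋₊ with hφ
  have hφm : Monotone φ := fun i j hij => by
    refine Nat.floor_mono ?_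
    have : (i : ℝ) ≤ j := by exact_mod_cast hij
    gcongr
  have hφ0 : φ 0 = 0 := by
    simp only [hφ, Nat.floor_eq_zero]
    rw [div_lt_one hpi]; simpa using hδπ
  -- As `ψ ≤ π`, no block is skipped, which makes `β` surjective.
  have hφs : ∀ j, φ (j + 1) ≤ φ j + 1 := fun j => by
    simp only [hφ]
    rw [← Nat.floor_add_one (by positivity)]
    refine Nat.floor_mono ?_
    rw [div_add_one hpi.ne']
    exact div_le_div_of_nonneg_right (by push_cast; linarith) hpi.le
  have hcast : ((n - 1 : ℕ) : ℝ) = n - 1 := by rw [Nat.cast_sub hn]; simp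
  have hφr : φ (n - 1) < r := by
    simp only [hφ]
    rw [Nat.floor_lt (by positivity), div_lt_iff₀ hpi, hcast]
    linarith
  set k := φ (n - 1) + 1 with hk
  have hkr : k ≤ r := hφr
  set β : Fin n → Fin k := fun j => ⟨φ j, by
    have := hφm (show (j : ℕ) ≤ n - 1 by omega); omega⟩ with hβ
  have hβm : Monotone β := fun i j hij => hφm hij
  have hβs : Function.Surjective β := by
    rintro ⟨b, hb⟩
    have hex : ∃ j, b ≤ φ j := ⟨n - 1, by omega⟩
    have h1 := Nat.find_spec hex
    have h2 : Nat.find hex ≤ n - 1 := Nat.find_min' hex (by omega)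
    refine ⟨⟨Nat.find hex, by omega⟩, ?_⟩
    simp only [hβ, Fin.mk.injEq]
    refine le_antisymm ?_ h1
    rcases hj : Nat.find hex with _ | j
    · rw [hφ0]; exact Nat.zero_le _
    · have h3 := Nat.find_min hex (m := j) (by omega)
      have := hφs j
      omega
  set z : ℂ := (ρ : ℂ) * Complex.exp (ψ * Complex.I) with hz
  have hpow : ∀ j : ℕ, (Complex.exp (δ * Complex.I) * z ^ j).im =
      ρ ^ j * Real.sin (j * ψ + δ) := by
    intro j
    have : Complex.exp (δ * Complex.I) * z ^ j =
        ((ρ ^ j : ℝ) : ℂ) * Complex.exp ((j * ψ + δ : ℝ) * Complex.I) := by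
      rw [hz, mul_pow, ← Complex.exp_nat_mul, mul_left_comm, ← Complex.exp_add]
      push_cast
      ring_nf
    rw [this, Complex.im_ofReal_mul, Complex.exp_ofReal_mul_I_im]
  have key := det_initial_eq_zero (k := k) (n := n) (Nat.succ_pos _) (by omega)
    (v := fun j b => toeplitzEntry h.coeff b j)
    (x := fun j => ρ ^ (j : ℕ) * Real.sin (j * ψ + δ)) hβm hβs (fun J hJ => hT k hkr J hJ) ?_ ?_
  -- The initial minor is triangular with diagonal `h.coeff 0 > 0`: a contradiction.
  · rw [Matrix.det_of_isLowerTriangular] at key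
    · have : (∏ i : Fin k, h.coeff 0) = 0 := by
        rw [← key]
        refine Finset.prod_congr rfl fun i _ => ?_
        simp [toeplitzEntry]
      simp [h0.ne'] at this
    · intro i j hij
      simp only [Matrix.of_apply, toeplitzEntry, Fin.val_castLE]
      rw [if_neg]
      simpa using hij
  · funext b
    have h1 := sum_toeplitzEntry_mul_pow h (n := n) (s := b) (by omega) z
    rw [hroot, mul_zero] at h1
    have h2 := congrArg (fun y => (Complex.exp (δ * Complex.I) * y).im) h1
    simp only [mul_zero, Complex.zero_im, Finset.mul_sum, Complex.im_sum] at h2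
    simp only [Finset.sum_apply, Pi.smul_apply, smul_eq_mul, Pi.zero_apply]
    rw [← h2]
    refine Finset.sum_congr rfl fun j _ => ?_
    rw [mul_left_comm, Complex.im_ofReal_mul, hpow, mul_comm]
  · intro j
    have h1 := neg_one_pow_floor_mul_sin_pos (y := (j : ℕ) * ψ + δ) (by positivity) (hgen j)
    have h2 : 0 < ρ ^ (j : ℕ) := by positivity
    have h3 := mul_pos h2 h1
    rw [mul_left_comm] at h3
    exact h3

/-! ### The zero-free sector of the polynomial. -/

theorem aeval_eq_contract (f : ℝ[X]) (w : ℂ) :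
    aeval w f = aeval (w ^ 2) (contract 2 f) + w * aeval (w ^ 2) (contract 2 f.divX) := by
  have : f = expand ℝ 2 (contract 2 f) + X * expand ℝ 2 (contract 2 f.divX) := by
    ext k
    rcases Nat.even_or_odd' k with ⟨u, rfl | rfl⟩
    · rcases u with _ | u
      · simp [coeff_expand, coeff_contract]
      · rw [coeff_add, show 2 * (u + 1) = 2 * u + 1 + 1 by ring, coeff_X_mul,
          coeff_expand two_pos, coeff_expand two_pos, if_pos (by omega), if_neg (by omega),
          coeff_contract two_ne_zero, add_zero]
        congr 1
        omega
    · rw [coeff_add, coeff_X_mul, coeff_expand two_pos, coeff_expand two_pos, if_neg (by omega),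
        if_pos (by omega), coeff_contract two_ne_zero, coeff_divX, zero_add]
      congr 1
      omega
  conv_lhs => rw [this]
  simp [expand_aeval]

theorem descCoeff_eq {n : ℕ} {p : ℝ[X]} (hp : p.natDegree = n) (k : ℤ) :
    descCoeff n p k = if 0 ≤ k then p.reverse.coeff k.toNat else 0 := by
  unfold descCoeff
  by_cases hk : 0 ≤ k
  · rw [if_pos hk]
    split_ifs with h
    · rw [coeff_reverse, revAt_le (by omega), hp]
    · rw [coeff_eq_zero_of_natDegree_lt]
      exact (reverse_natDegree_le p).trans_lt (by omega)
  · rw [if_neg hk, if_neg (by tauto)]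

theorem hurwitzMatrix_apply {n : ℕ} {p : ℝ[X]} (hp : p.natDegree = n) (i j : Fin n) :
    hurwitzMatrix n p i j =
      hurwitzEntry (contract 2 p.reverse) (contract 2 p.reverse.divX) i j := by
  rw [hurwitzMatrix, Matrix.of_apply, descCoeff_eq hp, hurwitzEntry]
  simp only [toeplitzEntry, coeff_contract two_ne_zero, coeff_divX]
  rcases Nat.even_or_odd' (i : ℕ) with ⟨u, hu | hu⟩
  · rw [if_pos (show Even (i : ℕ) from ⟨u, by omega⟩)]
    split_ifs with h1 h2 h2
    · congr 1; omega
    · omega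
    · omega
    · rfl
  · rw [if_neg (show ¬ Even (i : ℕ) by rw [Nat.not_even_iff_odd]; exact ⟨u, hu⟩)]
    split_ifs with h1 h2 h2
    · congr 1; omega
    · omega
    · omega
    · rfl

theorem IsTotallyNonneg.det_nonneg {n m k : ℕ} {A : Matrix (Fin n) (Fin m) ℝ}
    (hA : IsTotallyNonneg A) {F : ℕ → ℕ → ℝ} (hF : ∀ i j, A i j = F i j) {r c : Fin k → ℕ}
    (hr : StrictMono r) (hc : StrictMono c) (hrn : ∀ a, r a < n) (hcm : ∀ a, c a < m) :
    0 ≤ (Matrix.of fun a b => F (r a) (c b)).det := by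
  have := hA k (OrderEmbedding.ofStrictMono (fun a => ⟨r a, hrn a⟩) fun a b h => hr h)
    (OrderEmbedding.ofStrictMono (fun a => ⟨c a, hcm a⟩) fun a b h => hc h)
  convert this using 2
  ext a b
  simp only [Matrix.submatrix_apply, hF]
  rfl

theorem two_mul_sectorAngle {n : ℕ} (hn : 2 ≤ n) :
    (n - 1) * (2 * sectorAngle n) = ((n + 1) / 2 : ℕ) * Real.pi ∧ sectorAngle n ≤ Real.pi / 2 := by
  have hn' : (2 : ℝ) ≤ n := by exact_mod_cast hn
  have hn1 : (0 : ℝ) < n - 1 := by linarith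
  have hpi := Real.pi_pos
  unfold sectorAngle
  split_ifs with h
  · obtain ⟨m, rfl⟩ := h
    have h1 : (2 * m + 1 + 1) / 2 = m + 1 := by omega
    have h2 : (1 : ℝ) ≤ m := by exact_mod_cast (show 1 ≤ m by omega)
    rw [h1]
    push_cast at hn1 ⊢
    constructor
    · field_simp
      ring
    · rw [show Real.pi / 2 = Real.pi / 4 * 2 by ring]
      gcongr
      rw [div_le_iff₀ hn1]
      linarith
  · rw [Nat.not_odd_iff_even] at h
    obtain ⟨m, rfl⟩ := h
    have h1 : (m + m + 1) / 2 = m := by omega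
    rw [h1]
    push_cast at hn1 hn' ⊢
    rw [← two_mul] at hn1 hn' ⊢
    constructor
    · field_simp
      ring
    · rw [show Real.pi / 2 = Real.pi / 4 * 2 by ring]
      gcongr
      rw [div_le_iff₀ hn1]
      linarith

theorem aeval_ne_zero_of_isTotallyNonneg {n : ℕ} (hn : 2 ≤ n) {p : ℝ[X]} (hp : p.natDegree = n)
    (hlead : 0 < p.leadingCoeff) (hp0 : 0 < p.coeff 0) (hA : IsTotallyNonneg (hurwitzMatrix n p))
    {z : ℂ} (hz : |z.arg| < sectorAngle n) : aeval z p ≠ 0 := by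
  intro hroot
  obtain ⟨hangle, hangle2⟩ := two_mul_sectorAngle hn
  have hpi := Real.pi_pos
  have hz0 : z ≠ 0 := by
    rintro rfl
    rw [← coeff_zero_eq_aeval_zero'] at hroot
    simp [hp0.ne'] at hroot
  set e := contract 2 p.reverse with he
  set o := contract 2 p.reverse.divX with ho
  have hec : ∀ k, e.coeff k = p.reverse.coeff (2 * k) := fun k => by
    rw [he, coeff_contract two_ne_zero, mul_comm]
  have hoc : ∀ k, o.coeff k = p.reverse.coeff (2 * k + 1) := fun k => by
    rw [ho, coeff_contract two_ne_zero, coeff_divX, mul_comm]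
  have hrev : ∀ k, n < k → p.reverse.coeff k = 0 := fun k hk =>
    coeff_eq_zero_of_natDegree_lt ((reverse_natDegree_le p).trans_lt (by omega))
  have hedeg : ∀ k, n < 2 * k → e.coeff k = 0 := fun k hk => by rw [hec, hrev _ hk]
  have hodeg : ∀ k, n < 2 * k + 1 → o.coeff k = 0 := fun k hk => by rw [hoc, hrev _ hk]
  have he0 : 0 < e.coeff 0 := by rw [hec]; simpa using hlead
  have hminor : ∀ {k : ℕ} {r c : Fin k → ℕ}, StrictMono r → StrictMono c → (∀ a, r a < n) →
      (∀ a, c a < n) → 0 ≤ (Matrix.of fun a b => hurwitzEntry e o (r a) (c b)).det :=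
    hA.det_nonneg (hurwitzMatrix_apply hp)
  have hinit : InitialMinorsNonneg n e o := fun k hk c hc hcn =>
    hminor (r := fun i => (i : ℕ)) (fun _ _ h => h) hc (fun a => by omega) hcn
  have hre : 0 < z.re := by
    have h1 := abs_lt.mp (hz.trans_le hangle2)
    have h2 := Real.cos_pos_of_mem_Ioo (x := z.arg) ⟨h1.1, h1.2⟩
    rw [Complex.cos_arg hz0] at h2
    exact (div_pos_iff_of_pos_right (norm_pos_iff.mpr hz0)).mp h2
  have hw : aeval z⁻¹ p.reverse = 0 := by
    let _ := invertibleOfNonzero hz0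
    have := (eval₂_reverse_eq_zero_iff (algebraMap ℝ ℂ) z p).mpr hroot
    rwa [invOf_eq_inv] at this
  rw [aeval_eq_contract] at hw
  have hboth := hinit.aeval_eq_zero he0 hedeg hodeg
    (w := z⁻¹) (by rw [Complex.inv_re]; exact div_pos hre (Complex.normSq_pos.mpr hz0)) hw
  have hne : ∀ {h : ℝ[X]} {r : ℕ}, h.natDegree + r ≤ n → 0 < h.coeff 0 → r = (n + 1) / 2 →
      (∀ k ≤ r, ∀ J : Fin k → Fin n, StrictMono J →
        0 ≤ (Matrix.of fun a b : Fin k => toeplitzEntry h.coeff b (J a)).det) →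
      aeval (z⁻¹ ^ 2) h ≠ 0 := by
    intro h r hdeg h0 hr hT hzero
    have hv : z⁻¹ ^ 2 = ((‖z‖⁻¹ ^ 2 : ℝ) : ℂ) * Complex.exp ((-2 * z.arg : ℝ) * Complex.I) := by
      conv_lhs => rw [← Complex.norm_mul_exp_arg_mul_I z]
      rw [mul_inv, ← Complex.exp_neg, mul_pow, ← Complex.exp_nat_mul]
      push_cast
      ring_nf
    -- The argument of `z⁻¹ ^ 2` is `-2 * z.arg` up to full turns; when `z.arg` is nonnegative, the
    -- conjugate root is used to obtain the angle `2 * |z.arg|`.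
    refine aeval_ne_zero_of_toeplitz (by omega) hdeg h0 hT (ρ := ‖z‖⁻¹ ^ 2) (ψ := 2 * |z.arg|)
      (by have := norm_pos_iff.mpr hz0; positivity) (by positivity) (by linarith) ?_ ?_
    · rw [← hr] at hangle
      rw [← hangle]
      have : (2 : ℝ) ≤ n := by exact_mod_cast hn
      refine mul_lt_mul_of_pos_left (by linarith) (by linarith)
    · rcases abs_cases z.arg with ⟨h1, -⟩ | ⟨h1, -⟩
      · have h2 := congrArg (starRingEnd ℂ) hzero
        rw [hv, ← aeval_conj, map_mul, Complex.conj_ofReal, ← Complex.exp_conj, map_mul,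
          Complex.conj_ofReal, Complex.conj_I, map_zero] at h2
        rw [h1, ← h2]
        congr 3
        push_cast; ring_nf
      · rw [h1, ← hzero, hv]
        congr 4
        ring_nf
  rcases Nat.even_or_odd' n with ⟨m, hm | hm⟩
  · refine hne (h := e) (r := m) ?_ he0 (by omega) ?_ hboth.1
    · have : e.natDegree ≤ m := natDegree_le_iff_coeff_eq_zero.mpr fun k hk => hedeg k (by omega)
      omega
    · intro k hk J hJ
      rw [← Matrix.det_transpose]
      convert hminor (r := fun b : Fin k => 2 * b + 1) (c := fun a => J a)
        (fun a b h => by rw [Fin.lt_def] at h; simp only; omega) (fun a b h => hJ h)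
        (fun a => by omega) (fun a => by omega) using 2
      ext a b
      have : (2 * (a : ℕ) + 1) / 2 = a := by omega
      simp [hurwitzEntry, this]
  -- If `o.coeff 0` were zero, `o` would vanish, but for odd `n` its coefficient at `m` is `p.coeff
  -- 0`.
  · have ho0 : 0 < o.coeff 0 := by
      refine lt_of_le_of_ne (hinit.odd_coeff_nonneg (by omega)) fun h => ?_
      have h1 := hinit.odd_eq_zero he0 hodeg h.symm
      have h2 := hoc m
      rw [h1, ← hm, coeff_reverse, revAt_le hp.ge, hp, Nat.sub_self, coeff_zero] at h2
      exact hp0.ne h2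
    refine hne (h := o) (r := m + 1) ?_ ho0 (by omega) ?_ hboth.2
    · have : o.natDegree ≤ m := natDegree_le_iff_coeff_eq_zero.mpr fun k hk => hodeg k (by omega)
      omega
    · intro k hk J hJ
      rw [← Matrix.det_transpose]
      convert hminor (r := fun b : Fin k => 2 * b) (c := fun a => J a)
        (fun a b h => by rw [Fin.lt_def] at h; simp only; omega) (fun a b h => hJ h)
        (fun a => by omega) (fun a => by omega) using 2
      ext a b
      simp [hurwitzEntry]

/-! ### Gaussian binomial coefficients on the unit circle. -/

/-- The symmetric Gaussian binomial coefficients at `q = exp(2it)`, that is, the coefficients of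
`∏ (X + exp(i t (m - 1 - 2j)))` over `j < m`. -/
noncomputable def gaussCoeff (t : ℝ) : ℕ → ℕ → ℝ
  | 0, 0 => 1
  | 0, _ + 1 => 0
  | m + 1, 0 => gaussCoeff t m 0
  | m + 1, k + 1 => Real.cos (t * (m - k)) * gaussCoeff t m k +
      Real.cos (t * (k + 1)) * gaussCoeff t m (k + 1)

theorem gaussCoeff_zero_right (t : ℝ) (m : ℕ) : gaussCoeff t m 0 = 1 := by
  induction m with
  | zero => rfl
  | succ m ih => exact ih

theorem gaussCoeff_eq_zero (t : ℝ) {m k : ℕ} (h : m < k) : gaussCoeff t m k = 0 := by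
  induction m generalizing k with
  | zero =>
    obtain ⟨k, rfl⟩ := Nat.exists_eq_succ_of_ne_zero h.ne'
    rfl
  | succ m ih =>
    obtain ⟨k, rfl⟩ := Nat.exists_eq_succ_of_ne_zero (Nat.ne_zero_of_lt h)
    rw [Nat.succ_eq_add_one, gaussCoeff, ih (by omega), ih (by omega)]
    simp

theorem gaussCoeff_symm (t : ℝ) {m k l : ℕ} (h : k + l = m) :
    gaussCoeff t m k = gaussCoeff t m l := by
  induction m generalizing k l with
  | zero =>
    have hk : k = 0 := by omega
    have hl : l = 0 := by omega
    rw [hk, hl]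
  | succ m ih =>
    have haux : gaussCoeff t (m + 1) (m + 1) = gaussCoeff t (m + 1) 0 := by
      rw [gaussCoeff, gaussCoeff, gaussCoeff_eq_zero t (Nat.lt_succ_self m),
        ih (k := m) (l := 0) rfl]
      simp
    rcases k with _ | k
    · rw [← haux]; congr 1; omega
    rcases l with _ | l
    · rw [← haux]; congr 1
    rw [gaussCoeff, gaussCoeff, ih (k := k) (l := l + 1) (by omega),
      ih (k := k + 1) (l := l) (by omega)]
    have hm : (m : ℝ) = k + l + 1 := by
      have : m = k + l + 1 := by omega
      rw [this]; push_cast; ring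
    rw [hm, show (k : ℝ) + l + 1 - k = l + 1 by ring, show (k : ℝ) + l + 1 - l = k + 1 by ring]
    ring

/-- The quotient rule for neighbouring Gaussian binomials. It is also the vanishing of the imaginary
part of the `q`-Pascal rule, whose real part is the cosine recursion of `gaussCoeff`. -/
theorem sin_mul_gaussCoeff (t : ℝ) (m k : ℕ) :
    Real.sin (t * (k + 1)) * gaussCoeff t m (k + 1) =
      Real.sin (t * (m - k)) * gaussCoeff t m k := by
  induction m generalizing k with
  | zero => rcases k with _ | k <;> simp [gaussCoeff]
  | succ m ih =>
    rcases k with _ | k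
    · have h0 := ih 0
      rw [gaussCoeff, gaussCoeff]
      have e1 := Real.sin_add t (t * m)
      rw [show t + t * m = t * (m + 1) by ring] at e1
      simp only [Nat.cast_zero, Nat.cast_add, Nat.cast_one, zero_add, mul_one, sub_zero] at h0 ⊢
      rw [e1]
      linear_combination Real.cos t * h0
    · have h0 := ih k
      have h1 := ih (k + 1)
      rw [gaussCoeff, gaussCoeff]
      push_cast at h1 ⊢
      rw [show t * ((m : ℝ) + 1 - (k + 1)) = t * (m - k) by ring]
      have e1 := Real.sin_add (t * (k + 1 + 1)) (t * (m - (k + 1)))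
      have e2 := Real.sin_add (t * (k + 1)) (t * (m - k))
      rw [show t * (k + 1 + 1) + t * (m - (k + 1)) = t * (m + 1) by ring] at e1
      rw [show t * (k + 1) + t * (m - k) = t * (m + 1) by ring, e1] at e2
      linear_combination Real.cos (t * (k + 1 + 1)) * h1 + Real.cos (t * (m - k)) * h0 +
        gaussCoeff t m (k + 1) * e2

/-- A factorization of the Toeplitz matrix of the Gaussian binomial coefficients, up to a diagonal
factor, into a bidiagonal matrix and the Toeplitz matrix of smaller order. -/
theorem sin_mul_toeplitzEntry_gaussCoeff (t s : ℝ) (m i j : ℕ) :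
    Real.sin (t * j + s) * toeplitzEntry (gaussCoeff t (m + 1)) i j =
      Real.sin (t * i + s) * toeplitzEntry (gaussCoeff t m) i j +
        Real.sin (t * (m + 1 + i) + s) * toeplitzEntry (gaussCoeff t m) (i + 1) j := by
  rcases lt_trichotomy j i with h | rfl | h
  · simp [toeplitzEntry, not_le.mpr h, not_le.mpr (h.trans (Nat.lt_succ_self i))]
  · simp [toeplitzEntry, gaussCoeff]
  · obtain ⟨k, rfl⟩ := Nat.exists_eq_add_of_lt h
    have h1 : i + k + 1 - i = k + 1 := by omega
    have h2 : i + k + 1 - (i + 1) = k := by omega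
    simp only [toeplitzEntry, h1, h2, h.le, Nat.succ_le_of_lt h, if_true, gaussCoeff]
    have h0 := sin_mul_gaussCoeff t m k
    push_cast
    have e1 := Real.sin_sub (t * (i + k + 1) + s) (t * (k + 1))
    have e2 := Real.sin_add (t * (i + k + 1) + s) (t * (m - k))
    rw [show t * (i + k + 1) + s - t * (k + 1) = t * i + s by ring] at e1
    rw [show t * (i + k + 1) + s + t * (m - k) = t * (m + 1 + i) + s by ring] at e2
    rw [e1, e2]
    linear_combination Real.cos (t * (i + k + 1) + s) * h0

/-! ### Total nonnegativity of the Gaussian Toeplitz matrices. -/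

theorem det_nonneg_of_monotone {k : ℕ} {F : ℕ → Fin k → ℝ} {r : Fin k → ℕ} (hr : Monotone r)
    (h : StrictMono r → 0 ≤ (Matrix.of fun a => F (r a)).det) :
    0 ≤ (Matrix.of fun a => F (r a)).det := by
  by_cases hinj : Function.Injective r
  · exact h (hr.strictMono_of_injective hinj)
  · simp only [Function.Injective, not_forall] at hinj
    obtain ⟨a, b, hab, hne⟩ := hinj
    refine (Matrix.det_zero_of_row_eq hne ?_).ge
    change F (r a) = F (r b)
    rw [hab]

/-- Cauchy–Binet for a bidiagonal left factor: moving strictly increasing rows by `0` or `1` leaves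
them weakly increasing, and repeated rows contribute zero. -/
theorem det_bidiagonal_nonneg {k R : ℕ} {F : ℕ → Fin k → ℝ}
    (hF : ∀ r : Fin k → ℕ, StrictMono r → (∀ a, r a ≤ R) → 0 ≤ (Matrix.of fun a => F (r a)).det)
    {u : Fin k → Fin 2 → ℝ} (hu : ∀ a e, 0 ≤ u a e) {r : Fin k → ℕ} (hr : StrictMono r)
    (hrR : ∀ a, r a + 1 ≤ R) :
    0 ≤ (Matrix.of fun a => ∑ e : Fin 2, u a e • F (r a + e)).det := by
  have h1 := (Matrix.detRowAlternating (R := ℝ) (n := Fin k)).toMultilinearMap.map_sum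
    (fun a (e : Fin 2) => u a e • F (r a + e))
  refine le_of_le_of_eq (Finset.sum_nonneg fun e _ => ?_) h1.symm
  rw [MultilinearMap.map_smul_univ]
  refine mul_nonneg (Finset.prod_nonneg fun a _ => hu a _) ?_
  refine det_nonneg_of_monotone (r := fun a => r a + e a) (fun a b hab => ?_)
    fun h => hF _ h fun a => ?_
  · rcases hab.eq_or_lt with rfl | hab
    · exact le_rfl
    · have := hr hab
      simp only
      omega
  · have := hrR a
    omega

/-- Induction on `m` through the bidiagonal factorization. All the sines that occur have arguments
in `(0, π)`; the shift `s` keeps the one at index `0` positive. -/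
theorem det_toeplitz_gaussCoeff_nonneg_of_lt {t s : ℝ} {N : ℕ} (ht : 0 ≤ t) (hs : 0 < s)
    (hN : t * N + s < Real.pi) (m : ℕ) {k : ℕ} {r c : Fin k → ℕ} (hr : StrictMono r)
    (hc : StrictMono c) (hrN : ∀ a, r a + m ≤ N) (hcN : ∀ a, c a ≤ N) :
    0 ≤ (Matrix.of fun a b => toeplitzEntry (gaussCoeff t m) (r a) (c b)).det := by
  have hsin : ∀ j : ℕ, j ≤ N → 0 < Real.sin (t * j + s) := fun j hj => by
    have : (j : ℝ) ≤ N := by exact_mod_cast hj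
    exact Real.sin_pos_of_pos_of_lt_pi (by positivity)
      (lt_of_le_of_lt (by gcongr) hN)
  induction m generalizing r with
  | zero =>
    have hent : ∀ i j, toeplitzEntry (gaussCoeff t 0) i j = if i = j then 1 else 0 := by
      intro i j
      rcases lt_trichotomy i j with h | rfl | h
      · rw [toeplitzEntry, if_pos h.le, if_neg h.ne, gaussCoeff_eq_zero t (by omega)]
      · simp [toeplitzEntry, gaussCoeff]
      · rw [toeplitzEntry, if_neg (not_le.mpr h), if_neg h.ne']
    by_cases h : ∀ a, ∃ b, r a = c b
    · choose f hf using h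
      have hfi : Function.Injective f := fun a b hab =>
        hr.injective (by rw [hf, hf, hab])
      have hrange : Set.range r = Set.range c := by
        rw [show r = c ∘ f from funext hf,
          (Finite.surjective_of_injective hfi).range_comp]
      have hrc : r = c := (hr.range_inj hc).mp hrange
      have : (Matrix.of fun a b => toeplitzEntry (gaussCoeff t 0) (r a) (c b)) = 1 := by
        ext a b
        simp [hent, hrc, hc.injective.eq_iff, Matrix.one_apply]
      rw [this, Matrix.det_one]
      exact zero_le_one
    · push Not at h
      obtain ⟨a, ha⟩ := h
      rw [Matrix.det_eq_zero_of_row_eq_zero a]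
      intro b
      simp [hent, ha b]
  | succ m ih =>
    have h1 := det_bidiagonal_nonneg (R := N - m)
      (F := fun i b => toeplitzEntry (gaussCoeff t m) i (c b))
      (fun r hr hR => ih hr fun a => by have := hR a; have := hrN a; omega)
      (u := fun a => ![Real.sin (t * r a + s), Real.sin (t * ((m + 1 + r a : ℕ) : ℝ) + s)])
      (fun a e => by
        have := hrN a
        fin_cases e
        · exact (hsin _ (by omega)).le
        · exact (hsin _ (by omega)).le) hr (fun a => by have := hrN a; omega)
    have h2 := Matrix.det_mul_row (fun b => Real.sin (t * c b + s))
      (Matrix.of fun a b => toeplitzEntry (gaussCoeff t (m + 1)) (r a) (c b))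
    have h3 : (Matrix.of fun a b => Real.sin (t * c b + s) *
        (Matrix.of fun a b => toeplitzEntry (gaussCoeff t (m + 1)) (r a) (c b)) a b) =
        Matrix.of fun a => ∑ e : Fin 2,
          (![Real.sin (t * r a + s), Real.sin (t * ((m + 1 + r a : ℕ) : ℝ) + s)] : Fin 2 → ℝ) e •
            fun b => toeplitzEntry (gaussCoeff t m) (r a + e) (c b) := by
      ext a b
      simp [sin_mul_toeplitzEntry_gaussCoeff]
    rw [h3] at h2
    rw [h2] at h1
    exact nonneg_of_mul_nonneg_right h1 (Finset.prod_pos fun b _ => hsin _ (hcN b))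

theorem continuous_gaussCoeff (m k : ℕ) : Continuous fun t => gaussCoeff t m k := by
  induction m generalizing k with
  | zero => rcases k with _ | k <;> exact continuous_const
  | succ m ih =>
    rcases k with _ | k
    · exact ih 0
    · have h1 := ih k
      have h2 := ih (k + 1)
      simp only [gaussCoeff]
      fun_prop

/-- At `t = π / N` no shift `s > 0` is left, so the inequality is obtained as a limit from smaller
`t`. -/
theorem det_toeplitz_gaussCoeff_nonneg {N : ℕ} (hN : 0 < N) (m : ℕ) {k : ℕ} {r c : Fin k → ℕ}
    (hr : StrictMono r) (hc : StrictMono c) (hrN : ∀ a, r a + m ≤ N) (hcN : ∀ a, c a ≤ N) :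
    0 ≤ (Matrix.of fun a b =>
      toeplitzEntry (gaussCoeff (Real.pi / N) m) (r a) (c b)).det := by
  have hN' : (0 : ℝ) < N := by exact_mod_cast hN
  have hcont : Continuous fun t =>
      (Matrix.of fun a b => toeplitzEntry (gaussCoeff t m) (r a) (c b)).det := by
    refine Continuous.matrix_det (continuous_matrix fun a b => ?_)
    simp only [Matrix.of_apply, toeplitzEntry]
    split_ifs
    · exact continuous_gaussCoeff _ _
    · exact continuous_const
  have hpos : 0 < Real.pi / N := div_pos Real.pi_pos hN'
  have hmem : Real.pi / N ∈ closure (Set.Ioo 0 (Real.pi / N)) := by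
    rw [closure_Ioo hpos.ne]
    exact ⟨hpos.le, le_rfl⟩
  refine closure_minimal (fun t ht => ?_) (isClosed_le continuous_const hcont) hmem
  have h1 : t * N < Real.pi := (lt_div_iff₀ hN').mp ht.2
  exact det_toeplitz_gaussCoeff_nonneg_of_lt ht.1.le (s := (Real.pi - t * N) / 2)
    (by linarith) (by linarith) m hr hc hrN hcN

/-! ### Factorization of the Gaussian binomial polynomial. -/

/-- The Gaussian binomial polynomial in factored form. -/
noncomputable def gaussProd (t : ℝ) (m : ℕ) : ℂ[X] :=
  ∏ j ∈ Finset.range m, (X + C (Complex.exp (Complex.I * ((t * (m - 1 - 2 * j) : ℝ) : ℂ))))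

/-- The Gaussian binomial polynomial with real coefficients. -/
noncomputable def gaussPoly (t : ℝ) (m : ℕ) : ℝ[X] :=
  ∑ k ∈ Finset.range (m + 1), monomial k (gaussCoeff t m k)

theorem coeff_gaussPoly (t : ℝ) (m k : ℕ) : (gaussPoly t m).coeff k = gaussCoeff t m k := by
  rw [gaussPoly, finsetSum_coeff]
  simp only [coeff_monomial, Finset.sum_ite_eq', Finset.mem_range]
  split_ifs with h
  · rfl
  · rw [gaussCoeff_eq_zero t (by omega)]

theorem coeff_gaussProd (t : ℝ) (m k : ℕ) : (gaussProd t m).coeff k = gaussCoeff t m k := by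
  induction m generalizing k with
  | zero => rcases k with _ | k <;> simp [gaussProd, gaussCoeff, coeff_one]
  | succ m ih =>
    set q := Complex.exp (Complex.I * t) with hq
    -- `H` is the product of order `m` with its roots rotated; it arises from the dilation `X ↦ qX`,
    -- and one new factor completes order `m + 1`.
    set H : ℂ[X] := ∏ j ∈ Finset.range m,
      (X + C (q⁻¹ * Complex.exp (Complex.I * ((t * (m - 1 - 2 * j) : ℝ) : ℂ)))) with hH
    have hq0 : q ≠ 0 := Complex.exp_ne_zero _
    have hqm : ∀ l : ℕ, q ^ l = Complex.exp (Complex.I * (t * l)) := fun l => by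
      rw [hq, ← Complex.exp_nat_mul]; ring_nf
    have h1 : gaussProd t (m + 1) = H * (X + C (q ^ m)) := by
      rw [gaussProd, Finset.prod_range_succ', hH, hqm]
      congr 1
      · refine Finset.prod_congr rfl fun j _ => ?_
        rw [hq, ← Complex.exp_neg, ← Complex.exp_add]
        push_cast
        ring_nf
      · push_cast
        ring_nf
    have h2 : C (q ^ m) * H = (gaussProd t m).comp (C q * X) := by
      rw [hH, gaussProd, prod_comp, C_pow, ← Finset.card_range m, ← Finset.prod_const,
        Finset.card_range, ← Finset.prod_mul_distrib]
      refine Finset.prod_congr rfl fun j _ => ?_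
      rw [add_comp, X_comp, C_comp, mul_add, ← C_mul, mul_inv_cancel_left₀ hq0]
    have h3 : ∀ l, q ^ m * H.coeff l = gaussCoeff t m l * q ^ l := fun l => by
      have := congrArg (fun p => p.coeff l) h2
      simp only [coeff_C_mul, comp_C_mul_X_coeff, ih] at this
      exact this
    rw [h1]
    rcases k with _ | k
    · rw [mul_coeff_zero, coeff_add, coeff_X_zero, coeff_C_zero, zero_add, mul_comm, h3]
      simp [gaussCoeff]
    · rw [mul_add, coeff_add, coeff_mul_X, coeff_mul_C, mul_comm _ (q ^ m), h3, gaussCoeff]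
      have h4 : H.coeff k = gaussCoeff t m k * Complex.exp (-(t * (m - k) : ℝ) * Complex.I) := by
        refine mul_left_cancel₀ (pow_ne_zero m hq0) ?_
        rw [h3, hqm, hqm, mul_left_comm (Complex.exp _), ← Complex.exp_add]
        push_cast
        ring_nf
      have h5 : q ^ (k + 1) = Complex.exp ((t * (k + 1) : ℝ) * Complex.I) := by
        rw [hqm]; push_cast; ring_nf
      rw [h4, h5, ← Complex.ofReal_neg, Complex.exp_mul_I, Complex.exp_mul_I,
        ← Complex.ofReal_cos, ← Complex.ofReal_sin, ← Complex.ofReal_cos, ← Complex.ofReal_sin,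
        Real.cos_neg, Real.sin_neg]
      have h6 := congrArg (fun x : ℝ => (x : ℂ)) (sin_mul_gaussCoeff t m k)
      simp only [Complex.ofReal_mul] at h6
      rw [Complex.ofReal_add, Complex.ofReal_mul, Complex.ofReal_mul, Complex.ofReal_neg]
      linear_combination Complex.I * h6

theorem map_gaussPoly (t : ℝ) (m : ℕ) :
    (gaussPoly t m).map (algebraMap ℝ ℂ) = gaussProd t m := by
  ext k
  rw [coeff_map, coeff_gaussPoly, coeff_gaussProd, Complex.coe_algebraMap]

theorem gaussCoeff_self (t : ℝ) (m : ℕ) : gaussCoeff t m m = 1 := by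
  rw [gaussCoeff_symm t (l := 0) (by omega), gaussCoeff_zero_right]

theorem natDegree_gaussPoly (t : ℝ) (m : ℕ) : (gaussPoly t m).natDegree = m :=
  natDegree_eq_of_le_of_coeff_ne_zero
    (natDegree_le_iff_coeff_eq_zero.mpr fun k hk => by
      rw [coeff_gaussPoly, gaussCoeff_eq_zero t hk])
    (by rw [coeff_gaussPoly, gaussCoeff_self]; exact one_ne_zero)

theorem monic_gaussPoly (t : ℝ) (m : ℕ) : (gaussPoly t m).Monic := by
  rw [Monic, leadingCoeff, natDegree_gaussPoly, coeff_gaussPoly, gaussCoeff_self]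

/-! ### The extremal polynomial. -/

/-- If the even and the odd part have the coefficients of the same totally nonnegative Toeplitz
matrix, or vanish, the Hurwitz matrix is totally nonnegative. -/
theorem isTotallyNonneg_hurwitzMatrix_gauss {n m : ℕ} (hn : 2 ≤ n) (hnm : n ≤ 2 * m + 1)
    (hmn : 2 * m ≤ n) {p : ℝ[X]} (hp : p.natDegree = n)
    (he : ∀ k, (contract 2 p.reverse).coeff k = gaussCoeff (Real.pi / (n - 1 : ℕ)) m k)
    (ho : n = 2 * m + 1 → ∀ k,
      (contract 2 p.reverse.divX).coeff k = gaussCoeff (Real.pi / (n - 1 : ℕ)) m k)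
    (ho' : n = 2 * m → contract 2 p.reverse.divX = 0) :
    IsTotallyNonneg (hurwitzMatrix n p) := by
  intro k r c
  have hmono : Monotone fun a => (r a : ℕ) / 2 := fun a b hab =>
    Nat.div_le_div_right (r.monotone hab)
  have hc : StrictMono fun a => (c a : ℕ) := fun a b hab => c.strictMono hab
  -- Hurwitz rows `2u` and `2u + 1` give the same Toeplitz row `u`, so row indices may repeat after
  -- halving.
  have hT : (∀ a, (r a : ℕ) / 2 + m ≤ n - 1) → 0 ≤ (Matrix.of fun a b : Fin k =>
      toeplitzEntry (gaussCoeff (Real.pi / (n - 1 : ℕ)) m) ((r a : ℕ) / 2) (c b)).det :=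
    fun hr => det_nonneg_of_monotone
      (F := fun i b => toeplitzEntry (gaussCoeff (Real.pi / (n - 1 : ℕ)) m) i (c b)) hmono
      fun h => det_toeplitz_gaussCoeff_nonneg (by omega) m h hc hr fun a => by omega
  have he' := funext he
  by_cases hodd : n = 2 * m + 1
  · have ho := funext (ho hodd)
    refine le_of_le_of_eq (hT fun a => by omega) ?_
    congr 1
    ext a b
    simp [hurwitzMatrix_apply hp, hurwitzEntry, he', ho]
  · have hev : n = 2 * m := by omega
    by_cases hr : ∃ a, Even (r a : ℕ)
    · obtain ⟨a, ha⟩ := hr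
      refine (Matrix.det_eq_zero_of_row_eq_zero a fun b => ?_).ge
      simp [hurwitzMatrix_apply hp, hurwitzEntry, ha, ho' hev, toeplitzEntry]
    · push Not at hr
      refine le_of_le_of_eq (hT fun a => by omega) ?_
      congr 1
      ext a b
      simp [hurwitzMatrix_apply hp, hurwitzEntry, he', hr a]

theorem expand_gaussProd (t : ℝ) (m : ℕ) :
    expand ℂ 2 (gaussProd t m) = ∏ j ∈ Finset.Icc 1 m,
      (X ^ 2 + C (Complex.exp (Complex.I * ((t * (m + 1 - 2 * j) : ℝ) : ℂ)))) := by
  rw [gaussProd, map_prod]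
  refine Finset.prod_nbij' (fun j => j + 1) (fun j => j - 1) ?_ ?_ ?_ ?_ ?_
  · intro j hj; simp at hj ⊢; omega
  · intro j hj; simp at hj ⊢; omega
  · intro j _; rfl
  · intro j hj; simp at hj ⊢; omega
  · intro j _
    rw [map_add, expand_X, expand_C]
    congr 5
    push_cast
    ring

theorem exists_root_gaussPoly {n : ℕ} (hn : 2 ≤ n) :
    ∃ z : ℂ, z ≠ 0 ∧ |z.arg| = sectorAngle n ∧
      aeval (z ^ 2) (gaussPoly (Real.pi / (n - 1 : ℕ)) (n / 2)) = 0 := by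
  obtain ⟨h1, h2⟩ := two_mul_sectorAngle hn
  have hpi := Real.pi_pos
  have hn1 : (0 : ℝ) < ((n - 1 : ℕ) : ℝ) := by exact_mod_cast (by omega : 0 < n - 1)
  have hcast : ((n - 1 : ℕ) : ℝ) = n - 1 := by rw [Nat.cast_sub (by omega)]; simp
  rw [← hcast] at h1
  have hr : (0 : ℝ) < ((n + 1) / 2 : ℕ) := by exact_mod_cast (by omega : 0 < (n + 1) / 2)
  have h0 : 0 < sectorAngle n := by
    have : 0 < ((n - 1 : ℕ) : ℝ) * (2 * sectorAngle n) := by rw [h1]; positivity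
    have := (pos_iff_pos_of_mul_pos this).mp hn1
    linarith
  refine ⟨Complex.exp (sectorAngle n * Complex.I), Complex.exp_ne_zero _, ?_, ?_⟩
  · rw [Complex.exp_mul_I, Complex.arg_cos_add_sin_mul_I ⟨by linarith, by linarith⟩,
      abs_of_pos h0]
  · rw [aeval_def, ← eval_map, map_gaussPoly, gaussProd, eval_prod]
    -- With `m = n / 2`, the last factor has the root `-exp(-it(m - 1))`, of argument `π - π(m -
    -- 1)/(n - 1) = 2α_n`.
    refine Finset.prod_eq_zero (i := n / 2 - 1) (by rw [Finset.mem_range]; omega) ?_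
    have h3 : sectorAngle n * 2 = Real.pi / (n - 1 : ℕ) *
        ((n / 2 : ℕ) - 1 - 2 * ((n / 2 - 1 : ℕ) : ℝ)) + Real.pi := by
      have h4 : (((n / 2 - 1 : ℕ)) : ℝ) = (n / 2 : ℕ) - 1 := by
        rw [Nat.cast_sub (by omega)]; simp
      have h5 : ((n - 1 : ℕ) : ℝ) + 1 = (n / 2 : ℕ) + ((n + 1) / 2 : ℕ) := by
        exact_mod_cast (by omega : n - 1 + 1 = n / 2 + (n + 1) / 2)
      rw [h4]
      field_simp
      linear_combination h1 - Real.pi * h5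
    rw [eval_add, eval_X, eval_C, ← Complex.exp_nat_mul,
      show ((2 : ℕ) : ℂ) * (sectorAngle n * Complex.I) =
        ((sectorAngle n * 2 : ℝ) : ℂ) * Complex.I by push_cast; ring, h3, Complex.ofReal_add,
      add_mul, Complex.exp_add, Complex.exp_pi_mul_I]
    ring_nf

theorem exists_extremalPoly {n : ℕ} (hn : 2 ≤ n) :
    ∃ p : ℝ[X], p.map (algebraMap ℝ ℂ) = extremalPoly n ∧
      p.natDegree = n ∧ 0 < p.leadingCoeff ∧ 0 < p.coeff 0 ∧
      IsTotallyNonneg (hurwitzMatrix n p) ∧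
      ∃ z : ℂ, z ≠ 0 ∧ |z.arg| = sectorAngle n ∧ aeval z p = 0 := by
  obtain ⟨z, hz0, hzarg, hz⟩ := exists_root_gaussPoly hn
  have hn1 : ((n - 1 : ℕ) : ℝ) = n - 1 := by rw [Nat.cast_sub (by omega)]; simp
  have hn2 : (n : ℝ) - 1 ≠ 0 := by
    rw [← hn1]; exact_mod_cast (by omega : n - 1 ≠ 0)
  set t := Real.pi / (n - 1 : ℕ) with ht
  set m := n / 2 with hm
  set P := expand ℝ 2 (gaussPoly t m) with hP
  have hPm : P.Monic := (monic_expand_iff two_pos).mpr (monic_gaussPoly t m)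
  have hPd : P.natDegree = 2 * m := by
    rw [hP, natDegree_expand, natDegree_gaussPoly, mul_comm]
  have hPmap : P.map (algebraMap ℝ ℂ) = expand ℂ 2 (gaussProd t m) := by
    rw [hP, map_expand, map_gaussPoly]
  have hPe : ∀ k, P.coeff (2 * k) = gaussCoeff t m k := fun k => by
    rw [hP, mul_comm, coeff_expand_mul two_pos, coeff_gaussPoly]
  have hPo : ∀ k, P.coeff (2 * k + 1) = 0 := fun k => by
    rw [hP, coeff_expand two_pos, if_neg (by omega)]
  have hPz : aeval z P = 0 := by rw [hP, expand_aeval, hz]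
  have hP0 : P.coeff 0 = 1 := by simpa [gaussCoeff_zero_right] using hPe 0
  rcases Nat.even_or_odd n with hev | hodd
  · have hnm : n = 2 * m := by rw [hm]; exact (Nat.two_mul_div_two_of_even hev).symm
    have hPd' : P.natDegree = n := by omega
    refine ⟨P, ?_, hPd', by rw [hPm.leadingCoeff]; exact one_pos, by rw [hP0]; exact one_pos,
      ?_, z, hz0, hzarg, hPz⟩
    · rw [hPmap, expand_gaussProd, extremalPoly, if_neg (Nat.not_odd_iff_even.mpr hev)]
      refine Finset.prod_congr rfl fun j _ => ?_
      congr 5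
      rw [ht, hn1]
      have : (n : ℝ) = 2 * m := by exact_mod_cast hnm
      field_simp
      linear_combination -this
    · refine isTotallyNonneg_hurwitzMatrix_gauss hn (m := m) (by omega) (by omega) hPd'
        (fun k => ?_) (fun h => by omega) (fun _ => ?_)
      · rw [coeff_contract two_ne_zero, coeff_reverse, hPd']
        rcases le_or_gt k m with hk | hk
        · rw [revAt_le (by omega), show n - k * 2 = 2 * (m - k) by omega, hPe]
          exact gaussCoeff_symm t (by omega)
        -- Above the degree `revAt` fixes the index, and both sides are the same vanishing
        -- coefficient.
        · rw [revAt_eq_self_of_lt (by omega), mul_comm, hPe]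
      · ext k
        rw [coeff_contract two_ne_zero, coeff_divX, coeff_reverse, hPd', coeff_zero]
        rcases lt_or_ge k m with hk | hk
        · rw [revAt_le (by omega), show n - (k * 2 + 1) = 2 * (m - k - 1) + 1 by omega, hPo]
        · rw [revAt_eq_self_of_lt (by omega), mul_comm, hPo]
  · have hnm : n = 2 * m + 1 := by rw [hm]; exact (Nat.two_mul_div_two_add_one_of_odd hodd).symm
    have hX : (X + 1 : ℝ[X]).Monic := by simpa using monic_X_add_C (1 : ℝ)
    have hX' : (X + 1 : ℝ[X]).natDegree = 1 := by simpa using natDegree_X_add_C (1 : ℝ)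
    have hQm : ((X + 1) * P).Monic := hX.mul hPm
    have hQd : ((X + 1) * P).natDegree = n := by rw [hX.natDegree_mul hPm, hX', hPd]; omega
    have hQe : ∀ k, ((X + 1) * P).coeff (2 * k) = gaussCoeff t m k := fun k => by
      rw [add_mul, one_mul, coeff_add, hPe]
      rcases k with _ | k
      · simp
      · rw [show 2 * (k + 1) = 2 * k + 1 + 1 by ring, coeff_X_mul, hPo, zero_add]
    have hQo : ∀ k, ((X + 1) * P).coeff (2 * k + 1) = gaussCoeff t m k := fun k => by
      rw [add_mul, one_mul, coeff_add, hPo, coeff_X_mul, hPe, add_zero]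
    refine ⟨(X + 1) * P, ?_, hQd, by rw [hQm.leadingCoeff]; exact one_pos, ?_, ?_, z, hz0,
      hzarg, by rw [map_mul, hPz, mul_zero]⟩
    · rw [Polynomial.map_mul, hPmap, expand_gaussProd, extremalPoly, if_pos hodd,
        show (n - 1) / 2 = m by omega]
      congr 1
      · simp
      refine Finset.prod_congr rfl fun j _ => ?_
      congr 5
      rw [ht, hn1]
      have : (n : ℝ) = 2 * m + 1 := by exact_mod_cast hnm
      field_simp
      linear_combination -this
    · have := hQe 0
      rw [gaussCoeff_zero_right, mul_zero] at this
      rw [this]; exact one_pos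
    · refine isTotallyNonneg_hurwitzMatrix_gauss hn (m := m) (by omega) (by omega) hQd
        (fun k => ?_) (fun _ k => ?_) (fun h => by omega)
      · rw [coeff_contract two_ne_zero, coeff_reverse, hQd]
        rcases le_or_gt k m with hk | hk
        · rw [revAt_le (by omega), show n - k * 2 = 2 * (m - k) + 1 by omega, hQo]
          exact gaussCoeff_symm t (by omega)
        · rw [revAt_eq_self_of_lt (by omega), mul_comm k, hQe]
      · rw [coeff_contract two_ne_zero, coeff_divX, coeff_reverse, hQd]
        rcases le_or_gt k m with hk | hk
        · rw [revAt_le (by omega), show n - (k * 2 + 1) = 2 * (m - k) by omega, hQe]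
          exact gaussCoeff_symm t (by omega)
        · rw [revAt_eq_self_of_lt (by omega), mul_comm k, hQo]

/-- For every `n ≥ 2`: zeros of a real polynomial of degree `n` with `a₀, aₙ > 0` and totally
nonnegative finite Hurwitz matrix avoid the open sector, and the angle of the sector is sharp: the
extremal product is a real polynomial of this kind with a zero on the border of the sector. -/
theorem theorem2p1 (n : ℕ) (hn : 2 ≤ n) :
    (∀ p : ℝ[X], p.natDegree = n → 0 < p.leadingCoeff → 0 < p.coeff 0 →
      IsTotallyNonneg (hurwitzMatrix n p) →
      ∀ z : ℂ, |z.arg| < sectorAngle n → aeval z p ≠ 0) ∧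
    (∃ p : ℝ[X], p.map (algebraMap ℝ ℂ) = extremalPoly n ∧
      p.natDegree = n ∧ 0 < p.leadingCoeff ∧ 0 < p.coeff 0 ∧
      IsTotallyNonneg (hurwitzMatrix n p) ∧
      ∃ z : ℂ, z ≠ 0 ∧ |z.arg| = sectorAngle n ∧ aeval z p = 0) :=
  ⟨fun _ hp hlead hp0 hA _ hz => aeval_ne_zero_of_isTotallyNonneg hn hp hlead hp0 hA hz,
    exists_extremalPoly hn⟩
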